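/- **Theorem 1.3.** Let $M$ be a complex manifold of complex dimension $n\ge 1$ with complex structure $J$, let $h$ be a smooth Hermitian metric on $M$, and let $g=\operatorname{Re}h$ be its background Riemannian metric, with Levi-Civita connection $\nabla$. Put $$R(X,Y,Z,W)=g\big(\nabla_X\nabla_YZ-\nabla_Y\nabla_XZ-\nabla_{[X,Y]}Z,\,W\big),\qquad K(u,v)=\frac{R(u,v,v,u)}{g(u,u)g(v,v)-g(u,v)^2},$$ and extend $R$ complex multilinearly to $TM\otimes\mathbb C$. Assume that $h$ is Gray-Kähler-like (G-Kähler-like), i.e. in local holomorphic coordinates $R_{\alpha\beta\gamma\bar\delta}=R_{\alpha\beta\bar\gamma\bar\delta}=0$ for all $\alpha,\beta,\gamma,\delta\in\{1,\dots,n\}$. (a) Suppose that $K\ge 0$ on all 2-planes tangent to $M$. Then for every $p\in M$ the sectional curvature $K(u,v)$, restricted to 2-planes $\Pi(u,v)\subset T_pM$ spanned by nonzero orthogonal vectors $u,v$, attains its maximum, and it does so at a holomorphic plane section $\Pi(y,Jy)$ for some $0\ne y\in T_pM$. Consequently, if $K$ has a maximum over all such 2-planes at all points of $M$, then this maximum is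 attained at a holomorphic plane section. (b) Suppose that $K\le 0$ on all 2-planes tangent to $M$. Then the same holds with "minimum" in place of "maximum". -/

import Mathlib

open scoped Manifold ContDiff ComplexConjugate

noncomputable section

/-- The differential `d(φ⁻¹)_y : E → T_{φ⁻¹ y} M` of the inverse of the holomorphic chart `φ` of `M`
around `p`. It turns a constant vector of the model space `E` into a coordinate vector field. -/
def chartFrame {E : Type*} [NormedAddCommGroup E] [NormedSpace ℂ E]
    {M : Type*} [TopologicalSpace M] [ChartedSpace E M] (p : M) (y : E) :
    E →L[ℂ] TangentSpace 𝓘(ℂ, E) ((chartAt E p).symm y) :=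
  mfderiv 𝓘(ℂ, E) 𝓘(ℂ, E) (chartAt E p).symm y

/-- A smooth Hermitian metric `h` on the complex manifold `M` modelled on `E`. The real tangent
space, with its complex structure `J u = i • u`, is identified with `T^{1,0}` by
`u ↦ (u - i J u) / 2`. Smoothness is that of real `C^∞` functions: all components in the holomorphic
charts are `C^∞`. -/
structure HermitianMetric (E : Type*) [NormedAddCommGroup E] [NormedSpace ℂ E]
    (M : Type*) [TopologicalSpace M] [ChartedSpace E M] where
  /-- the Hermitian form on `T_x M`, linear in the first and conjugate linear in the second slot -/
  form : ∀ x : M, TangentSpace 𝓘(ℂ, E) x →ₗ[ℂ] TangentSpace 𝓘(ℂ, E) x →ₗ⋆[ℂ] ℂ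
  conj_symm : ∀ (x : M) (u v : TangentSpace 𝓘(ℂ, E) x), conj (form x u v) = form x v u
  pos : ∀ (x : M) (u : TangentSpace 𝓘(ℂ, E) x), u ≠ 0 → 0 < (form x u u).re
  smooth : ∀ (p : M) (u v : E),
    ContDiffOn ℝ ∞ (fun y : E => form ((chartAt E p).symm y) (chartFrame p y u) (chartFrame p y v))
      (chartAt E p).target

/-! ### Levi-Civita connection and curvature of a metric on (an open subset of) a vector space -/

section Local

variable {E : Type*} [NormedAddCommGroup E] [NormedSpace ℝ E]

/-- The Christoffel symbols of the first kind of the metric `G`, as a functional of the last slot: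
`z ↦ (∂_u G(v, z) + ∂_v G(u, z) - ∂_z G(u, v)) / 2`. -/
def christoffelLower (G : E → E →L[ℝ] E →L[ℝ] ℝ) (y u v : E) : E →L[ℝ] ℝ :=
  (1 / 2 : ℝ) • (fderiv ℝ G y u v + fderiv ℝ G y v u - ((fderiv ℝ G y).flip u).flip v)

/-- The Christoffel symbols `Γ_y(u, v)` of the metric `G`: the vector with
`G_y(Γ_y(u, v), z) = (∂_u G(v, z) + ∂_v G(u, z) - ∂_z G(u, v)) / 2` for all `z`. -/
def christoffel (G : E → E →L[ℝ] E →L[ℝ] ℝ) (y u v : E) : E :=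
  (G y).inverse (christoffelLower G y u v)

/-- The Levi-Civita connection `∇_X Y = ∂_X Y + Γ(X, Y)` of the metric `G`. -/
def leviCivita (G : E → E →L[ℝ] E →L[ℝ] ℝ) (X Y : E → E) : E → E :=
  fun y => fderiv ℝ Y y (X y) + christoffel G y (X y) (Y y)

/-- The curvature `R(X, Y) Z = ∇_X ∇_Y Z - ∇_Y ∇_X Z - ∇_{[X, Y]} Z` of the metric `G`. -/
def curvatureOperator (G : E → E →L[ℝ] E →L[ℝ] ℝ) (X Y Z : E → E) : E → E :=
  leviCivita G X (leviCivita G Y Z) - leviCivita G Y (leviCivita G X Z)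
    - leviCivita G (VectorField.lieBracket ℝ X Y) Z

/-- The curvature tensor `R(u, v, w, z) = G(R(u, v) w, z)` at `y`, with `u, v, w` extended to
constant (i.e. coordinate) vector fields. -/
def localCurvature (G : E → E →L[ℝ] E →L[ℝ] ℝ) (y u v w z : E) : ℝ :=
  G y (curvatureOperator G (fun _ => u) (fun _ => v) (fun _ => w) y) z

end Local

namespace HermitianMetric

variable {E : Type*} [NormedAddCommGroup E] [NormedSpace ℂ E]
  {M : Type*} [TopologicalSpace M] [ChartedSpace E M]

/-- The background Riemannian metric `g = Re h`. -/
def riem (h : HermitianMetric E M) (x : M) (u v : TangentSpace 𝓘(ℂ, E) x) : ℝ :=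
  (h.form x u v).re

/-- The complex structure `J` on the tangent spaces. -/
def J {x : M} (u : TangentSpace 𝓘(ℂ, E) x) : TangentSpace 𝓘(ℂ, E) x := Complex.I • u

/-- The Riemannian metric `g = Re h` in the chart of `M` around `p`. -/
def chartMetric [FiniteDimensional ℂ E] (h : HermitianMetric E M) (p : M) (y : E) :
    E →L[ℝ] E →L[ℝ] ℝ :=
  haveI : FiniteDimensional ℝ E := FiniteDimensional.complexToReal E
  (LinearMap.mk₂ ℝ
    (fun u v => h.riem ((chartAt E p).symm y) (chartFrame p y u) (chartFrame p y v))
    (fun u u' v => by simp [riem])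
    (fun c u v => by
      rw [← Complex.coe_smul c u]
      simp [riem, -Complex.coe_smul])
    (fun u v v' => by simp [riem])
    (fun c u v => by
      rw [← Complex.coe_smul c v]
      simp [riem, -Complex.coe_smul])).toContinuousBilinearMap

/-- The Riemannian curvature tensor `R(u, v, w, z) = g((∇_u ∇_v - ∇_v ∇_u - ∇_{[u, v]}) w, z)` at
`p`, computed in the chart around `p`. The tangent space at `p` is by definition the model space `E`,
the identification being the differential at `p` of this very chart. -/
def curvature [FiniteDimensional ℂ E] (h : HermitianMetric E M) (p : M)
    (u v w z : TangentSpace 𝓘(ℂ, E) p) : ℝ :=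
  localCurvature (E := E) (h.chartMetric p) (chartAt E p p) u v w z

/-- The sectional curvature of the 2-plane spanned by `u` and `v`. -/
def sectionalCurvature [FiniteDimensional ℂ E] (h : HermitianMetric E M) (p : M)
    (u v : TangentSpace 𝓘(ℂ, E) p) : ℝ :=
  h.curvature p u v v u / (h.riem p u u * h.riem p v v - h.riem p u v ^ 2)

/-- The complex multilinear extension of the curvature tensor to the complexified tangent space
`T_p M ⊗ ℂ`, whose element `a + i b` (`a`, `b` real tangent vectors) is written `![a, b]`. -/
def complexCurvature [FiniteDimensional ℂ E] (h : HermitianMetric E M) (p : M)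
    (X Y Z W : Fin 2 → TangentSpace 𝓘(ℂ, E) p) : ℂ :=
  ∑ i : Fin 2, ∑ j : Fin 2, ∑ k : Fin 2, ∑ l : Fin 2,
    Complex.I ^ (i.val + j.val + k.val + l.val) * (h.curvature p (X i) (Y j) (Z k) (W l) : ℂ)

/-- The vector `u_o = (u - i J u) / 2` of type `(1,0)`; as `u` varies these are all of
`T^{1,0}_p M`. -/
def holPart {p : M} (u : TangentSpace 𝓘(ℂ, E) p) : Fin 2 → TangentSpace 𝓘(ℂ, E) p :=
  ![(1 / 2 : ℝ) • u, -((1 / 2 : ℝ) • J u)]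

/-- The conjugate `(u + i J u) / 2` of `u_o`, a vector of type `(0,1)`. -/
def antiholPart {p : M} (u : TangentSpace 𝓘(ℂ, E) p) : Fin 2 → TangentSpace 𝓘(ℂ, E) p :=
  ![(1 / 2 : ℝ) • u, (1 / 2 : ℝ) • J u]

/-- `h` is Gray-Kähler-like: the components `R_{α β γ \bar δ}` and `R_{α β \bar γ \bar δ}` of the
complexified Riemannian curvature tensor vanish. -/
def IsGKahlerLike [FiniteDimensional ℂ E] (h : HermitianMetric E M) : Prop :=
  ∀ (p : M) (a b c d : TangentSpace 𝓘(ℂ, E) p),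
    h.complexCurvature p (holPart a) (holPart b) (holPart c) (antiholPart d) = 0 ∧
    h.complexCurvature p (holPart a) (holPart b) (antiholPart c) (antiholPart d) = 0

/-- The sectional curvature of every 2-plane of `M` is non-negative. -/
def NonnegSectionalCurvature [FiniteDimensional ℂ E] (h : HermitianMetric E M) : Prop :=
  ∀ (p : M) (u v : TangentSpace 𝓘(ℂ, E) p), LinearIndependent ℝ ![u, v] →
    0 ≤ h.sectionalCurvature p u v

/-- The sectional curvature of every 2-plane of `M` is non-positive. -/
def NonposSectionalCurvature [FiniteDimensional ℂ E] (h : HermitianMetric E M) : Prop :=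
  ∀ (p : M) (u v : TangentSpace 𝓘(ℂ, E) p), LinearIndependent ℝ ![u, v] →
    h.sectionalCurvature p u v ≤ 0

/-- The values at `p` of the sectional curvature on the 2-planes `Π(u, v)` with `u, v` nonzero and
orthogonal. -/
def orthogonalCurvatures [FiniteDimensional ℂ E] (h : HermitianMetric E M) (p : M) : Set ℝ :=
  {c | ∃ u v : TangentSpace 𝓘(ℂ, E) p, u ≠ 0 ∧ v ≠ 0 ∧ h.riem p u v = 0 ∧
    h.sectionalCurvature p u v = c}

end HermitianMetric

end

/-!
At a point, the proof is linear algebra of the curvature tensor `R`. The Gray-Kähler-like condition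
gives `R_{αβγ\bar δ} = R_{αβ\bar γ\bar δ} = 0`. The components `R_{αβγδ}` vanish for every Hermitian
metric on a complex manifold: in holomorphic coordinates `G(∂_α, ∂_β) = 0`, so the Christoffel
symbols of two fields of type `(1, 0)` are of type `(1, 0)` (`I_smul_christoffel_sub`,
`localCurvature_holomorphic_eq_zero`). Together they say that `R(J u, J v, w, z) = R(u, v, w, z)`
(`IsCurvatureTensor.I_smul_I_smul_left`), i.e. `R` is algebraically a Kähler curvature tensor.

For such a tensor `R(u, v, ·, ·)` depends only on `u ∧ v + J u ∧ J v`, which is a combination of the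
complex lines through `p = u + J v` and `q = u - J v`. This gives
`16 R(u, v, v, u) = R(p, Jp, Jp, p) + R(q, Jq, Jq, q) - 2 R(p, Jp, Jq, q)`
(`IsCurvatureTensor.sixteen_mul_eq`), and for orthonormal `u, v` the vectors `p` and `q` are
orthogonal over `ℂ`. The bisectional term is a sum of two sectional curvatures, hence nonnegative if
`K ≥ 0`. If `H` is the maximum of the holomorphic sectional curvature at the point, which exists by
compactness, and `c = g(u, J v)`, then `|p|² = 2 + 2c` and `|q|² = 2 - 2c` give
`16 K(u, v) ≤ 8 H (1 + c²) ≤ 16 H`. The case `K ≤ 0` is the same statement for `-R`.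

The link between the two parts is the coordinate formula for the curvature in terms of the second
derivatives of the metric and the Christoffel symbols (`localCurvature_eq`), from which the
symmetries of `R` are read off.
-/

-- Needed for instances on the space of iterated linear maps in which derivatives of a metric lie.
set_option maxSynthPendingDepth 3

open Topology

/-! ### The curvature of a metric in a chart -/

section Local

variable {E : Type*} [NormedAddCommGroup E] [NormedSpace ℝ E]

theorem christoffelLower_apply (G : E → E →L[ℝ] E →L[ℝ] ℝ) (y u v z : E) :
    christoffelLower G y u v z =
      (1 / 2) * (fderiv ℝ G y u v z + fderiv ℝ G y v u z - fderiv ℝ G y z u v) := by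
  simp [christoffelLower]

theorem metric_christoffel {G : E → E →L[ℝ] E →L[ℝ] ℝ} {y : E} (hinv : (G y).IsInvertible)
    (u v z : E) : G y (christoffel G y u v) z = christoffelLower G y u v z := by
  obtain ⟨e, he⟩ := hinv
  rw [christoffel, ← he, ContinuousLinearMap.inverse_equiv]
  simp

/-- The second derivative `∂_a ∂_b G(c, d)` of the metric. -/
noncomputable def metricHessian (G : E → E →L[ℝ] E →L[ℝ] ℝ) (y a b c d : E) : ℝ :=
  fderiv ℝ (fderiv ℝ G) y a b c d

section Symmetries

variable {G : E → E →L[ℝ] E →L[ℝ] ℝ} {y : E}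

theorem fderiv_metric_apply (hG : DifferentiableAt ℝ G y) (a b c : E) :
    fderiv ℝ (fun x => G x b c) y a = fderiv ℝ G y a b c := by
  have h1 : HasFDerivAt G (fderiv ℝ G y) y := hG.hasFDerivAt
  have h2 := (h1.clm_apply (hasFDerivAt_const b y)).clm_apply (hasFDerivAt_const c y)
  rw [h2.fderiv]
  simp

theorem hasFDerivAt_fderiv_metric_apply (hG : ContDiffAt ℝ 2 G y) (b c d : E) :
    HasFDerivAt (fun x => fderiv ℝ G x b c d)
      (((fderiv ℝ (fderiv ℝ G) y).flip b).flip c |>.flip d) y := by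
  have h0 : DifferentiableAt ℝ (fderiv ℝ G) y :=
    (hG.fderiv_right (m := 1) (by norm_num)).differentiableAt (by norm_num)
  have h1 := ((h0.hasFDerivAt.clm_apply (hasFDerivAt_const b y)).clm_apply
    (hasFDerivAt_const c y)).clm_apply (hasFDerivAt_const d y)
  refine h1.congr_fderiv ?_
  ext a
  simp

/-- A pointwise bilinear identity satisfied by the metric near `y` is inherited by its first
derivatives near `y`. -/
theorem eventually_fderiv_metric_eq (hG : ContDiffAt ℝ 2 G y) {b c b' c' : E}
    (h : ∀ᶠ x in 𝓝 y, G x b c = G x b' c') :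
    ∀ᶠ x in 𝓝 y, ∀ a, fderiv ℝ G x a b c = fderiv ℝ G x a b' c' := by
  filter_upwards [h.eventually_nhds, hG.eventually (by norm_num)] with x hx hGx a
  have hd : DifferentiableAt ℝ G x := hGx.differentiableAt (by norm_num)
  rw [← fderiv_metric_apply hd, ← fderiv_metric_apply hd, Filter.EventuallyEq.fderiv_eq hx]

/-- A pointwise bilinear identity satisfied by the metric near `y` is inherited by its second
derivatives at `y`. -/
theorem metricHessian_eq (hG : ContDiffAt ℝ 2 G y) {b c b' c' : E}
    (h : ∀ᶠ x in 𝓝 y, G x b c = G x b' c') (a d : E) :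
    metricHessian G y a d b c = metricHessian G y a d b' c' := by
  have h1 : (fun x => fderiv ℝ G x d b c) =ᶠ[𝓝 y] fun x => fderiv ℝ G x d b' c' :=
    (eventually_fderiv_metric_eq hG h).mono fun x hx => hx d
  have h2 : fderiv ℝ (fun x => fderiv ℝ G x d b c) y =
      fderiv ℝ (fun x => fderiv ℝ G x d b' c') y := h1.fderiv_eq
  rw [(hasFDerivAt_fderiv_metric_apply hG d b c).fderiv,
    (hasFDerivAt_fderiv_metric_apply hG d b' c').fderiv] at h2
  exact congrArg (fun L : E →L[ℝ] ℝ => L a) h2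

theorem metricHessian_comm (hG : ContDiffAt ℝ 2 G y) (a b c d : E) :
    metricHessian G y a b c d = metricHessian G y b a c d := by
  have := hG.isSymmSndFDerivAt (by simp) a b
  unfold metricHessian
  rw [this]

end Symmetries

theorem differentiableAt_christoffel [CompleteSpace E] {G : E → E →L[ℝ] E →L[ℝ] ℝ} {y : E}
    (hG : ContDiffAt ℝ 2 G y) (hinv : (G y).IsInvertible) (v w : E) :
    DifferentiableAt ℝ (fun x => christoffel G x v w) y := by
  have h0 : DifferentiableAt ℝ (fderiv ℝ G) y :=
    (hG.fderiv_right (m := 1) (by norm_num)).differentiableAt (by norm_num)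
  have h1 : DifferentiableAt ℝ (fun x => (G x).inverse) y :=
    ((hinv.contDiffAt_map_inverse (n := 1)).differentiableAt (by norm_num)).comp y
      (hG.differentiableAt (by norm_num))
  have h2 : DifferentiableAt ℝ (fun x => christoffelLower G x v w) y := by
    unfold christoffelLower
    have h3 : DifferentiableAt ℝ (fun x => ((fderiv ℝ G x).flip v).flip w) y := by
      have h4 : DifferentiableAt ℝ (fun x => (fderiv ℝ G x).flip v) y :=
        ((ContinuousLinearMap.flipₗᵢ ℝ E E (E →L[ℝ] ℝ)).differentiableAt.comp y h0).clm_apply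
          (differentiableAt_const v)
      exact ((ContinuousLinearMap.flipₗᵢ ℝ E E ℝ).differentiableAt.comp y h4).clm_apply
          (differentiableAt_const w)
    exact ((((h0.clm_apply (differentiableAt_const v)).clm_apply (differentiableAt_const w)).add
      ((h0.clm_apply (differentiableAt_const w)).clm_apply (differentiableAt_const v))).sub
      h3).const_smul (1 / 2 : ℝ)
  exact h1.clm_apply h2

/-- The classical coordinate formula
`G(∂_u Γ(v, w) + Γ(u, Γ(v, w)), z) = ∂_u (G(Γ(v, w), z)) - G(Γ(u, z), Γ(v, w))`. -/
theorem metric_leviCivita_leviCivita [CompleteSpace E] {G : E → E →L[ℝ] E →L[ℝ] ℝ} {y : E}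
    (hG : ContDiffAt ℝ 2 G y) (hinv : (G y).IsInvertible)
    (hsymm : ∀ᶠ x in 𝓝 y, ∀ a b, G x a b = G x b a) (u v w z : E) :
    G y (leviCivita G (fun _ => u) (leviCivita G (fun _ => v) (fun _ => w)) y) z =
      (1 / 2) * (metricHessian G y u v w z + metricHessian G y u w v z
        - metricHessian G y u z v w)
      - G y (christoffel G y u z) (christoffel G y v w) := by
  have hconst : leviCivita G (fun _ => v) (fun _ => w) = fun x => christoffel G x v w := by
    ext1 x; simp [leviCivita]
  rw [hconst, leviCivita, map_add, add_apply, metric_christoffel hinv,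
    metric_christoffel hinv]
  have hd := differentiableAt_christoffel hG hinv v w
  have hGd : DifferentiableAt ℝ G y := hG.differentiableAt (by norm_num)
  -- Differentiate `x ↦ G_x(Γ_x(v, w), z)` at `y` in two ways.
  have hprod := ((hGd.hasFDerivAt.clm_apply hd.hasFDerivAt).clm_apply (hasFDerivAt_const z y))
  have hinv' : ∀ᶠ x in 𝓝 y, (G x).IsInvertible := by
    obtain ⟨e, he⟩ := hinv
    have := hG.continuousAt.eventually (he ▸ e.nhds)
    exact this
  have hlow : HasFDerivAt (fun x => christoffelLower G x v w z) ((1 / 2 : ℝ) •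
      ((((fderiv ℝ (fderiv ℝ G) y).flip v).flip w |>.flip z)
       + (((fderiv ℝ (fderiv ℝ G) y).flip w).flip v |>.flip z)
       - (((fderiv ℝ (fderiv ℝ G) y).flip z).flip v |>.flip w))) y := by
    simp only [christoffelLower_apply]
    exact (((hasFDerivAt_fderiv_metric_apply hG v w z).add
      (hasFDerivAt_fderiv_metric_apply hG w v z)).sub
      (hasFDerivAt_fderiv_metric_apply hG z v w)).const_mul _
  have heq : (fun x => G x (christoffel G x v w) z) =ᶠ[𝓝 y]
      fun x => christoffelLower G x v w z :=
    hinv'.mono fun x hx => metric_christoffel hx v w z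
  have hfd := congrArg (fun L : E →L[ℝ] ℝ => L u)
    (hprod.unique (hlow.congr_of_eventuallyEq heq))
  simp only [add_apply, smul_apply,
    sub_apply, ContinuousLinearMap.flip_apply,
    ContinuousLinearMap.comp_apply, zero_apply, map_zero, zero_add,
    smul_eq_mul] at hfd
  have hs : ∀ a b c, fderiv ℝ G y a b c = fderiv ℝ G y a c b := fun a b c =>
    (eventually_fderiv_metric_eq hG (hsymm.mono fun x hx => hx b c)).self_of_nhds a
  simp only [metricHessian, christoffelLower_apply]
  set Γ := christoffel G y v w
  have := hs u Γ z
  have := hs z Γ u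
  have := hs Γ z u
  have := hs u z Γ
  linarith

/-- The coordinate formula for the curvature tensor of type `(0, 4)`. -/
theorem localCurvature_eq [CompleteSpace E] {G : E → E →L[ℝ] E →L[ℝ] ℝ} {y : E}
    (hG : ContDiffAt ℝ 2 G y) (hinv : (G y).IsInvertible)
    (hsymm : ∀ᶠ x in 𝓝 y, ∀ a b, G x a b = G x b a) (u v w z : E) :
    localCurvature G y u v w z =
      (1 / 2) * (metricHessian G y u w v z - metricHessian G y u z v w
        - metricHessian G y v w u z + metricHessian G y v z u w)
      - G y (christoffel G y u z) (christoffel G y v w)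
      + G y (christoffel G y v z) (christoffel G y u w) := by
  have hbr : leviCivita G (VectorField.lieBracket ℝ (fun _ => u) (fun _ => v)) (fun _ => w) y
      = 0 := by
    have h0 : christoffelLower G y 0 w = 0 := by
      ext z; simp [christoffelLower_apply]
    simp [leviCivita, VectorField.lieBracket, christoffel, h0]
  simp only [localCurvature, curvatureOperator, Pi.sub_apply, hbr, sub_zero, map_sub,
    sub_apply, metric_leviCivita_leviCivita hG hinv hsymm]
  rw [metricHessian_comm hG v u w z]
  ring

end Local

/-! ### Algebraic curvature tensors of Kähler type -/

theorem I_smul_I_smul {V : Type*} [AddCommGroup V] [Module ℂ V] (u : V) :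
    Complex.I • Complex.I • u = -u := by
  rw [smul_smul, Complex.I_mul_I, neg_one_smul]

/-- An algebraic curvature tensor on a real vector space: a quadrilinear form with the symmetries of
a Riemannian curvature tensor. Linearity is only required in the first slot, as the symmetries carry
it to the others. -/
structure IsCurvatureTensor {V : Type*} [AddCommGroup V] [Module ℝ V] (R : V → V → V → V → ℝ) :
    Prop where
  add_left : ∀ u u' v w z, R (u + u') v w z = R u v w z + R u' v w z
  smul_left : ∀ (c : ℝ) u v w z, R (c • u) v w z = c * R u v w z
  swap_left : ∀ u v w z, R v u w z = -R u v w z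
  swap_right : ∀ u v w z, R u v z w = -R u v w z
  bianchi : ∀ u v w z, R u v w z + R v w u z + R w u v z = 0

namespace IsCurvatureTensor

section Real

variable {V : Type*} [AddCommGroup V] [Module ℝ V] {R : V → V → V → V → ℝ}

theorem neg (hR : IsCurvatureTensor R) : IsCurvatureTensor (fun u v w z => -R u v w z) where
  add_left u u' v w z := by rw [hR.add_left]; ring
  smul_left c u v w z := by rw [hR.smul_left]; ring
  swap_left u v w z := by rw [hR.swap_left]
  swap_right u v w z := by rw [hR.swap_right]
  bianchi u v w z := by linarith [hR.bianchi u v w z]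

theorem pair_symm (hR : IsCurvatureTensor R) (u v w z : V) : R u v w z = R w z u v := by
  linarith [hR.bianchi u v w z, hR.bianchi v w z u, hR.bianchi w z u v, hR.bianchi z u v w,
    hR.swap_right u v w z, hR.swap_right v w z u, hR.swap_right w z u v, hR.swap_right z u v w,
    hR.swap_left u v w z, hR.swap_left w z u v, hR.swap_left u w v z, hR.swap_left v z u w,
    hR.swap_right u w v z, hR.swap_right v z u w, hR.swap_right w u v z, hR.swap_right z v u w,
    hR.swap_left v w z u, hR.swap_left z u v w]

variable (hR : IsCurvatureTensor R)
include hR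

theorem add_two (u v v' w z : V) : R u (v + v') w z = R u v w z + R u v' w z := by
  rw [hR.swap_left, hR.add_left, hR.swap_left v, hR.swap_left v']; ring

theorem smul_two (c : ℝ) (u v w z : V) : R u (c • v) w z = c * R u v w z := by
  rw [hR.swap_left, hR.smul_left, hR.swap_left v]; ring

theorem smul_three (c : ℝ) (u v w z : V) : R u v (c • w) z = c * R u v w z := by
  rw [hR.pair_symm, hR.smul_left, hR.pair_symm w]

theorem smul_four (c : ℝ) (u v w z : V) : R u v w (c • z) = c * R u v w z := by
  rw [hR.pair_symm, hR.smul_two, hR.pair_symm w]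

theorem neg_left (u v w z : V) : R (-u) v w z = -R u v w z := by
  rw [← neg_one_smul ℝ u, hR.smul_left]; ring

theorem neg_two (u v w z : V) : R u (-v) w z = -R u v w z := by
  rw [← neg_one_smul ℝ v, hR.smul_two]; ring

theorem neg_three (u v w z : V) : R u v (-w) z = -R u v w z := by
  rw [← neg_one_smul ℝ w, hR.smul_three]; ring

theorem self_left (u w z : V) : R u u w z = 0 := by
  linarith [hR.swap_left u u w z]

theorem smul_plane (a b : ℝ) (u v : V) :
    R (a • u) (b • v) (b • v) (a • u) = a ^ 2 * b ^ 2 * R u v v u := by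
  rw [hR.smul_left, hR.smul_two, hR.smul_three, hR.smul_four]; ring

end Real

section Kahler

variable {V : Type*} [AddCommGroup V] [Module ℂ V] {R : V → V → V → V → ℝ}
  (hR : IsCurvatureTensor R)
  (hJ : ∀ u v w z, R (Complex.I • u) (Complex.I • v) w z = R u v w z)

include hR hJ

/-- A curvature tensor of Kähler type only sees the `J`-invariant part of `u ∧ v`, and
`2 (u ∧ v + J u ∧ J v) = q ∧ J q - p ∧ J p` for `p = u + J v` and `q = u - J v`. -/
theorem four_mul_eq_sub (u v w z : V) :
    4 * R u v w z =
      R (u - Complex.I • v) (Complex.I • (u - Complex.I • v)) w z -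
        R (u + Complex.I • v) (Complex.I • (u + Complex.I • v)) w z := by
  simp only [sub_eq_add_neg, smul_add, smul_neg, I_smul_I_smul, hR.add_left, hR.add_two,
    hR.neg_left, hR.neg_two, hJ]
  linarith [hR.swap_left u v w z, hJ u v w z, hJ v u w z]

/-- The curvature of the plane `u ∧ v` in terms of the holomorphic sectional curvatures of
`u ± J v` and their bisectional curvature. -/
theorem sixteen_mul_eq (u v : V) :
    16 * R u v v u =
      R (u + Complex.I • v) (Complex.I • (u + Complex.I • v))
          (Complex.I • (u + Complex.I • v)) (u + Complex.I • v)
        + R (u - Complex.I • v) (Complex.I • (u - Complex.I • v))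
          (Complex.I • (u - Complex.I • v)) (u - Complex.I • v)
        - 2 * R (u + Complex.I • v) (Complex.I • (u + Complex.I • v))
          (Complex.I • (u - Complex.I • v)) (u - Complex.I • v) := by
  -- Apply the decomposition of `u ∧ v` in the first pair of slots, then in the second.
  have h1 := hR.four_mul_eq_sub hJ u v u v
  have h2 := fun x => hR.four_mul_eq_sub hJ u v x (Complex.I • x)
  have h3 := h2 (u - Complex.I • v)
  have h4 := h2 (u + Complex.I • v)
  set p := u + Complex.I • v
  set q := u - Complex.I • v
  rw [hR.pair_symm, hR.pair_symm p] at h1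
  linarith [hR.swap_right u v u v, hR.pair_symm q (Complex.I • q) p (Complex.I • p),
    hR.swap_right p (Complex.I • p) p (Complex.I • p),
    hR.swap_right q (Complex.I • q) q (Complex.I • q),
    hR.swap_right p (Complex.I • p) q (Complex.I • q), hR.pair_symm q (Complex.I • q) u v,
    hR.pair_symm p (Complex.I • p) u v]

/-- The bisectional curvature of a Kähler curvature tensor is a sum of two sectional curvatures. -/
theorem bisectional_eq (p q : V) :
    R p (Complex.I • p) (Complex.I • q) q =
      R p q q p + R p (Complex.I • q) (Complex.I • q) p := by
  have hJ' : ∀ u v w z, R u v (Complex.I • w) (Complex.I • z) = R u v w z := fun u v w z => by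
    rw [hR.pair_symm, hJ, hR.pair_symm]
  have h1 := hR.bianchi p (Complex.I • p) (Complex.I • q) q
  have h2 := hJ' (Complex.I • q) p (Complex.I • p) q
  rw [I_smul_I_smul, hR.neg_three] at h2
  linarith [hJ p q p q, hR.swap_right p q q p, hR.swap_left (Complex.I • q) p (Complex.I • q) p,
    hR.swap_right (Complex.I • q) p p (Complex.I • q),
    hR.swap_left p (Complex.I • q) (Complex.I • q) p]

end Kahler

end IsCurvatureTensor

/-! ### The maximum of the sectional curvature -/

section Maximum

variable {E : Type*} [NormedAddCommGroup E] [NormedSpace ℂ E]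

/-- The sectional curvature of the plane spanned by `u` and `v`, for the inner product `g` and the
curvature tensor `R`. -/
noncomputable def algSectionalCurvature (g : E →L[ℝ] E →L[ℝ] ℝ) (R : E → E → E → E → ℝ) (u v : E) : ℝ :=
  R u v v u / (g u u * g v v - g u v ^ 2)

theorem algSectionalCurvature_neg (g : E →L[ℝ] E →L[ℝ] ℝ) (R : E → E → E → E → ℝ) (u v : E) :
    algSectionalCurvature g (fun u v w z => -R u v w z) u v = -algSectionalCurvature g R u v :=
  neg_div _ _

variable {g : E →L[ℝ] E →L[ℝ] ℝ} {R : E → E → E → E → ℝ}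
  (hsymm : ∀ u v, g u v = g v u)
  (hgJ : ∀ u v, g (Complex.I • u) (Complex.I • v) = g u v)

include hsymm hgJ in
theorem metric_I_smul_self (u : E) : g u (Complex.I • u) = 0 := by
  have h := hgJ u (Complex.I • u)
  rw [I_smul_I_smul, map_neg, hsymm] at h
  linarith

variable (hpos : ∀ u, u ≠ 0 → 0 < g u u)

include hsymm hpos in
theorem linearIndependent_pair_of_metric_eq_zero {u v : E} (hu : u ≠ 0) (hv : v ≠ 0)
    (huv : g u v = 0) : LinearIndependent ℝ ![u, v] := by
  refine LinearIndependent.pair_iff.2 fun a b hab => ?_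
  have h1 := congrArg (fun x => g x u) hab
  have h2 := congrArg (fun x => g x v) hab
  simp only [map_add, map_smul, add_apply, smul_apply, smul_eq_mul, map_zero, zero_apply, huv,
    hsymm v u, mul_zero, add_zero, zero_add] at h1 h2
  exact ⟨(mul_eq_zero.1 h1).resolve_right (hpos u hu).ne',
    (mul_eq_zero.1 h2).resolve_right (hpos v hv).ne'⟩

variable
  (hR : IsCurvatureTensor R)
  (hJ : ∀ u v w z, R (Complex.I • u) (Complex.I • v) w z = R u v w z)
  (hnonneg : ∀ u v, g u v = 0 → 0 ≤ R u v v u)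

include hsymm hgJ hpos hR hJ hnonneg in
/-- A bound `H` for the holomorphic sectional curvatures bounds the curvature of every pair of
orthonormal vectors `u, v`: with `c = g(u, J v)`, the lengths `|u ± J v|² = 2 ± 2c` give
`16 R(u, v, v, u) ≤ 8 H (1 + c²)`. -/
theorem curvature_le_of_orthonormal {H : ℝ} (hH0 : 0 ≤ H)
    (hH : ∀ x, R x (Complex.I • x) (Complex.I • x) x ≤ H * g x x ^ 2) {u v : E}
    (hu : g u u = 1) (hv : g v v = 1) (huv : g u v = 0) : R u v v u ≤ H := by
  have key := hR.sixteen_mul_eq hJ u v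
  rw [hR.bisectional_eq hJ (u + Complex.I • v) (u - Complex.I • v)] at key
  have hJuv : g (Complex.I • v) u = g u (Complex.I • v) := hsymm _ _
  have hJv : g (Complex.I • v) (Complex.I • v) = 1 := by rw [hgJ, hv]
  have hp : g (u + Complex.I • v) (u + Complex.I • v) = 2 + 2 * g u (Complex.I • v) := by
    simp only [map_add, add_apply, hu, hJv, hJuv]; ring
  have hq : g (u - Complex.I • v) (u - Complex.I • v) = 2 - 2 * g u (Complex.I • v) := by
    simp only [map_sub, sub_apply, hu, hJv, hJuv]; ring
  have hpq : g (u + Complex.I • v) (u - Complex.I • v) = 0 := by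
    simp only [map_sub, map_add, add_apply, hu, hJv, hJuv]; ring
  have hpJq : g (u + Complex.I • v) (Complex.I • (u - Complex.I • v)) = 0 := by
    simp only [smul_sub, I_smul_I_smul, map_sub, map_neg, map_add,
      add_apply, hgJ, huv, metric_I_smul_self hsymm hgJ u,
      hsymm _ v, metric_I_smul_self hsymm hgJ v, hsymm v u]
    ring
  have h1 := hnonneg _ _ hpq
  have h2 := hnonneg _ _ hpJq
  have h3 := hH (u + Complex.I • v)
  have h4 := hH (u - Complex.I • v)
  rw [hp] at h3
  rw [hq] at h4
  have hg0 : ∀ x, 0 ≤ g x x := fun x => by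
    rcases eq_or_ne x 0 with rfl | hx
    · simp
    · exact (hpos x hx).le
  -- Positivity of `|u ± J v|²` is the Cauchy-Schwarz bound `c² ≤ 1`.
  have h5 := hg0 (u + Complex.I • v)
  have h6 := hg0 (u - Complex.I • v)
  rw [hp] at h5
  rw [hq] at h6
  have h7 : g u (Complex.I • v) ^ 2 ≤ 1 := by nlinarith
  nlinarith [mul_le_mul_of_nonneg_left h7 hH0]

include hsymm hgJ hpos hR hJ hnonneg in
/-- The sectional curvature of a nonnegatively curved Kähler curvature tensor is maximal on a
holomorphic plane, namely one that maximizes the holomorphic sectional curvature. -/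
theorem exists_forall_algSectionalCurvature_le [FiniteDimensional ℂ E] [Nontrivial E]
    (hcont : Continuous fun x => R x (Complex.I • x) (Complex.I • x) x) :
    ∃ y : E, y ≠ 0 ∧ ∀ u v, u ≠ 0 → v ≠ 0 → g u v = 0 →
      algSectionalCurvature g R u v ≤ algSectionalCurvature g R y (Complex.I • y) := by
  have : ProperSpace E := FiniteDimensional.proper ℂ E
  have hsec : ∀ x, algSectionalCurvature g R x (Complex.I • x) =
      R x (Complex.I • x) (Complex.I • x) x / g x x ^ 2 := fun x => by
    rw [algSectionalCurvature, hgJ, metric_I_smul_self hsymm hgJ]; ring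
  obtain ⟨y, hy, hmax⟩ := (isCompact_sphere (0 : E) 1).exists_isMaxOn
    ((NormedSpace.sphere_nonempty (x := (0 : E)) (r := 1)).2 zero_le_one)
    (f := fun x => R x (Complex.I • x) (Complex.I • x) x / g x x ^ 2)
    (by
      refine ContinuousOn.div hcont.continuousOn (by fun_prop) fun x hx => ?_
      have := hpos x (ne_zero_of_mem_unit_sphere ⟨x, hx⟩)
      positivity)
  have hy0 : y ≠ 0 := ne_zero_of_mem_unit_sphere ⟨y, hy⟩
  refine ⟨y, hy0, fun u v hu hv huv => ?_⟩
  set H := algSectionalCurvature g R y (Complex.I • y) with hHdef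
  have hJself : ∀ x, 0 ≤ R x (Complex.I • x) (Complex.I • x) x := fun x =>
    hnonneg _ _ (metric_I_smul_self hsymm hgJ x)
  have hH0 : 0 ≤ H := by
    rw [hHdef, hsec]
    exact div_nonneg (hJself y) (sq_nonneg _)
  have hH : ∀ x, R x (Complex.I • x) (Complex.I • x) x ≤ H * g x x ^ 2 := fun x => by
    rcases eq_or_ne x 0 with rfl | hx
    · simp [hR.self_left]
    have hn : 0 < ‖x‖ := norm_pos_iff.2 hx
    have hm : R (‖x‖⁻¹ • x) (Complex.I • ‖x‖⁻¹ • x) (Complex.I • ‖x‖⁻¹ • x) (‖x‖⁻¹ • x)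
        / g (‖x‖⁻¹ • x) (‖x‖⁻¹ • x) ^ 2 ≤ H := by
      rw [hHdef, hsec]
      exact hmax (by simp [norm_smul, hn.ne'])
    have hgx := hpos x hx
    rw [smul_comm Complex.I ‖x‖⁻¹ x, hR.smul_plane] at hm
    simp only [map_smul, smul_apply, smul_eq_mul] at hm
    rw [div_le_iff₀ (by positivity)] at hm
    have hk : 0 < ‖x‖⁻¹ ^ 2 * ‖x‖⁻¹ ^ 2 := by positivity
    refine le_of_mul_le_mul_left ?_ hk
    linarith
  have hgu := hpos u hu
  have hgv := hpos v hv
  have hnorm : ∀ x, 0 < g x x → g ((√(g x x))⁻¹ • x) ((√(g x x))⁻¹ • x) = 1 := fun x hx => by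
    have := Real.sqrt_pos.2 hx
    simp only [map_smul, smul_apply, smul_eq_mul]
    nth_rewrite 3 [← Real.sq_sqrt hx.le]
    field_simp
  have hbound := curvature_le_of_orthonormal hsymm hgJ hpos hR hJ hnonneg hH0 hH
    (hnorm u hgu) (hnorm v hgv) (by simp [huv])
  rw [hR.smul_plane, inv_pow, inv_pow, Real.sq_sqrt hgu.le, Real.sq_sqrt hgv.le] at hbound
  rw [algSectionalCurvature, huv]
  calc _ = (g u u)⁻¹ * (g v v)⁻¹ * R u v v u := by field_simp; ring
    _ ≤ H := hbound

end Maximum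

/-! ### Hermitian metrics in holomorphic charts -/

section Christoffel

variable {E : Type*} [NormedAddCommGroup E] [NormedSpace ℝ E] (G : E → E →L[ℝ] E →L[ℝ] ℝ) (y : E)

theorem christoffel_add_left (u u' v : E) :
    christoffel G y (u + u') v = christoffel G y u v + christoffel G y u' v := by
  have : christoffelLower G y (u + u') v =
      christoffelLower G y u v + christoffelLower G y u' v := by
    ext z; simp only [christoffelLower_apply, map_add, add_apply]; ring
  rw [christoffel, this, map_add, christoffel, christoffel]

theorem christoffel_smul_left (c : ℝ) (u v : E) :
    christoffel G y (c • u) v = c • christoffel G y u v := by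
  have : christoffelLower G y (c • u) v = c • christoffelLower G y u v := by
    ext z; simp only [christoffelLower_apply, map_smul, smul_apply, smul_eq_mul]; ring
  rw [christoffel, this, map_smul, christoffel]

theorem continuous_christoffel : Continuous fun x : E × E => christoffel G y x.1 x.2 := by
  unfold christoffel christoffelLower
  have h1 : Continuous fun x : E × E => ((fderiv ℝ G y).flip x.1).flip x.2 :=
    ((ContinuousLinearMap.flipₗᵢ ℝ E E ℝ).continuous.comp
      (((fderiv ℝ G y).flip).continuous.comp continuous_fst)).clm_apply continuous_snd
  fun_prop

variable {G y}

theorem christoffel_comm (hG : ContDiffAt ℝ 2 G y)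
    (hsymm : ∀ᶠ x in 𝓝 y, ∀ a b, G x a b = G x b a) (u v : E) :
    christoffel G y u v = christoffel G y v u := by
  have : christoffelLower G y u v = christoffelLower G y v u := by
    ext z
    rw [christoffelLower_apply, christoffelLower_apply,
      (eventually_fderiv_metric_eq hG (hsymm.mono fun x hx => hx u v)).self_of_nhds z]
    ring
  rw [christoffel, this, christoffel]

/-- The curvature of a Riemannian metric is an algebraic curvature tensor. -/
theorem isCurvatureTensor_localCurvature [CompleteSpace E] (hG : ContDiffAt ℝ 2 G y)
    (hinv : (G y).IsInvertible) (hsymm : ∀ᶠ x in 𝓝 y, ∀ a b, G x a b = G x b a) :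
    IsCurvatureTensor (localCurvature G y) := by
  have hΓ := christoffel_comm hG hsymm
  have hS : ∀ a b c d, metricHessian G y a b c d = metricHessian G y a b d c := fun a b c d =>
    metricHessian_eq hG (hsymm.mono fun x hx => hx c d) a b
  have hS' := metricHessian_comm hG
  have hsy := hsymm.self_of_nhds
  constructor
  · intro u u' v w z
    simp only [localCurvature_eq hG hinv hsymm, christoffel_add_left]
    simp only [metricHessian, map_add, add_apply]
    ring
  · intro c u v w z
    simp only [localCurvature_eq hG hinv hsymm, christoffel_smul_left]
    simp only [metricHessian, map_smul, smul_apply, smul_eq_mul]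
    ring
  · intro u v w z
    simp only [localCurvature_eq hG hinv hsymm]
    ring
  · intro u v w z
    simp only [localCurvature_eq hG hinv hsymm]
    rw [hsy (christoffel G y u w), hsy (christoffel G y v w)]
    ring
  · intro u v w z
    simp only [localCurvature_eq hG hinv hsymm]
    rw [hΓ v u, hΓ w u, hΓ w v]
    linear_combination (1 / 2) * (hS' u w v z + hS' w v u z + hS' v u w z + hS u z w v + hS v z u w
      + hS w z v u)

theorem continuous_localCurvature [CompleteSpace E] (hG : ContDiffAt ℝ 2 G y)
    (hinv : (G y).IsInvertible) (hsymm : ∀ᶠ x in 𝓝 y, ∀ a b, G x a b = G x b a)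
    {f₁ f₂ f₃ f₄ : E → E} (h₁ : Continuous f₁) (h₂ : Continuous f₂) (h₃ : Continuous f₃)
    (h₄ : Continuous f₄) :
    Continuous fun x => localCurvature G y (f₁ x) (f₂ x) (f₃ x) (f₄ x) := by
  have hΓ : ∀ {a b : E → E}, Continuous a → Continuous b →
      Continuous fun x => christoffel G y (a x) (b x) := fun {a b} ha hb =>
    Continuous.comp (f := fun x => (a x, b x)) (continuous_christoffel G y) (ha.prodMk hb)
  have hS : ∀ {a b c d : E → E}, Continuous a → Continuous b → Continuous c → Continuous d →
      Continuous fun x => metricHessian G y (a x) (b x) (c x) (d x) := fun ha hb hc hd =>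
    ((((fderiv ℝ (fderiv ℝ G) y).continuous.comp ha).clm_apply hb).clm_apply hc).clm_apply hd
  have hQ : ∀ {a b : E → E}, Continuous a → Continuous b →
      Continuous fun x => G y (a x) (b x) := fun ha hb =>
    ((G y).continuous.comp ha).clm_apply hb
  simp only [localCurvature_eq hG hinv hsymm]
  exact ((continuous_const.mul ((((hS h₁ h₃ h₂ h₄).sub (hS h₁ h₄ h₂ h₃)).sub
    (hS h₂ h₃ h₁ h₄)).add (hS h₂ h₄ h₁ h₃))).sub (hQ (hΓ h₁ h₄) (hΓ h₂ h₃))).add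
    (hQ (hΓ h₂ h₄) (hΓ h₁ h₃))

/-- A positive definite form on a finite-dimensional space is nondegenerate. Without this, the
raising of an index in `christoffel` would have a junk value. -/
theorem isInvertible_of_pos [FiniteDimensional ℝ E] {g : E →L[ℝ] E →L[ℝ] ℝ}
    (hpos : ∀ u, u ≠ 0 → 0 < g u u) : g.IsInvertible := by
  have hinj : Function.Injective g := by
    refine (injective_iff_map_eq_zero g).2 fun u hu => ?_
    by_contra h0
    have := hpos u h0
    simp [hu] at this
  have hrank : Module.finrank ℝ E = Module.finrank ℝ (E →L[ℝ] ℝ) := by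
    rw [← (LinearMap.toContinuousLinearMap (𝕜 := ℝ) (E := E) (F' := ℝ)).finrank_eq]
    exact (Subspace.dual_finrank_eq (K := ℝ) (V := E)).symm
  have : FiniteDimensional ℝ (E →L[ℝ] ℝ) :=
    (LinearMap.toContinuousLinearMap (𝕜 := ℝ) (E := E) (F' := ℝ)).finiteDimensional
  let e := (LinearMap.linearEquivOfInjective (g : E →ₗ[ℝ] E →L[ℝ] ℝ) hinj hrank)
  exact ⟨e.toContinuousLinearEquiv, by ext u v; rfl⟩

end Christoffel

section LocalHermitian

variable {E : Type*} [NormedAddCommGroup E] [NormedSpace ℂ E]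
  {G : E → E →L[ℝ] E →L[ℝ] ℝ} {y : E} (hG : ContDiffAt ℝ 2 G y) (hinv : (G y).IsInvertible)
  (hsymm : ∀ᶠ x in 𝓝 y, ∀ a b, G x a b = G x b a)
  (hJ : ∀ᶠ x in 𝓝 y, ∀ a b, G x (Complex.I • a) (Complex.I • b) = G x a b)


include hG hinv hsymm hJ

/-- The connection maps `T^{1,0} × T^{1,0}` to `T^{1,0}`: since `G` vanishes on pairs of
holomorphic coordinate fields, so does the Christoffel symbol of the first kind on triples. In real
terms, `Γ(u - i J u, v - i J v) = a - i b` is of type `(1, 0)` if and only if `b = J a`. -/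
theorem I_smul_christoffel_sub (u v : E) :
    Complex.I • (christoffel G y u v - christoffel G y (Complex.I • u) (Complex.I • v)) =
      christoffel G y (Complex.I • u) v + christoffel G y u (Complex.I • v) := by
  have hinj : Function.Injective (G y) := by
    obtain ⟨e, he⟩ := hinv
    rw [← he]; exact e.injective
  have hs : ∀ a b c, fderiv ℝ G y a b c = fderiv ℝ G y a c b := fun a b c =>
    (eventually_fderiv_metric_eq hG (hsymm.mono fun x hx => hx b c)).self_of_nhds a
  have hd : ∀ a b c, fderiv ℝ G y a (Complex.I • b) (Complex.I • c) = fderiv ℝ G y a b c :=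
    fun a b c => (eventually_fderiv_metric_eq hG (hJ.mono fun x hx => hx b c)).self_of_nhds a
  have hd' : ∀ a b c, fderiv ℝ G y a b (Complex.I • c) = -fderiv ℝ G y a (Complex.I • b) c :=
    fun a b c => by
      rw [← hd a b, I_smul_I_smul, map_neg]
  have hJ0 := hJ.self_of_nhds
  have hJ' : ∀ a b, G y (Complex.I • a) b = -G y a (Complex.I • b) := fun a b => by
    rw [← hJ0 a, I_smul_I_smul, map_neg, neg_neg]
  apply hinj
  ext z
  rw [hJ']
  simp only [map_sub, map_add, sub_apply, add_apply, metric_christoffel hinv,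
    christoffelLower_apply, hd, hd']
  linarith [hs v (Complex.I • u) z, hs u (Complex.I • v) z, hs z (Complex.I • u) v,
    hs (Complex.I • z) u v, hd' z u v, hd' v u z, hd' u v z]

/-- The component `R_{αβγδ}` of the curvature of a Hermitian metric vanishes: real part of the
identity `R(U, V, W, Z) = 0` for the vectors `U = u - i J u`, … of type `(1, 0)`. -/
theorem localCurvature_holomorphic_eq_zero [CompleteSpace E] (u v w z : E) :
    let J : E → E := fun a => Complex.I • a
    let R := localCurvature G y
    R u v w z - R (J u) (J v) w z - R (J u) v (J w) z - R (J u) v w (J z) - R u (J v) (J w) z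
      - R u (J v) w (J z) - R u v (J w) (J z) + R (J u) (J v) (J w) (J z) = 0 := by
  intro J R
  have hS : ∀ a b c d, metricHessian G y a b (J c) (J d) = metricHessian G y a b c d :=
    fun a b c d => metricHessian_eq hG (hJ.mono fun x hx => hx c d) a b
  have hS' : ∀ a b c d, metricHessian G y a b (J c) d = -metricHessian G y a b c (J d) :=
    fun a b c d => by
      rw [← hS a b c (J d)]
      simp only [J, I_smul_I_smul]
      simp [metricHessian]
  have hJ0 := hJ.self_of_nhds
  have hΓ : ∀ a b c d : E,
      G y (christoffel G y a b) (christoffel G y c d)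
        - G y (christoffel G y (J a) (J b)) (christoffel G y c d)
        - G y (christoffel G y (J a) b) (christoffel G y (J c) d)
        - G y (christoffel G y (J a) b) (christoffel G y c (J d))
        - G y (christoffel G y a (J b)) (christoffel G y (J c) d)
        - G y (christoffel G y a (J b)) (christoffel G y c (J d))
        - G y (christoffel G y a b) (christoffel G y (J c) (J d))
        + G y (christoffel G y (J a) (J b)) (christoffel G y (J c) (J d)) = 0 := by
    intro a b c d
    have h := hJ0 (christoffel G y a b - christoffel G y (J a) (J b))
      (christoffel G y c d - christoffel G y (J c) (J d))
    rw [I_smul_christoffel_sub hG hinv hsymm hJ, I_smul_christoffel_sub hG hinv hsymm hJ] at h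
    simp only [map_sub, map_add, sub_apply, add_apply] at h
    simp only [J] at h ⊢
    linarith
  simp only [R, localCurvature_eq hG hinv hsymm, hS, hS']
  linarith [hΓ u z v w, hΓ v z u w]

end LocalHermitian

/-! ### Gray-Kähler-like metrics have Kähler curvature tensors -/

section Gray

variable {V : Type*} [AddCommGroup V] [Module ℂ V]

/-- The curvature tensor `R` extended complex multilinearly to `V ⊗ ℂ`, whose element `a + i b` is
written `![a, b]`. -/
noncomputable def complexify (R : V → V → V → V → ℝ) (X Y Z W : Fin 2 → V) : ℂ :=
  ∑ i : Fin 2, ∑ j : Fin 2, ∑ k : Fin 2, ∑ l : Fin 2,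
    Complex.I ^ (i.val + j.val + k.val + l.val) * (R (X i) (Y j) (Z k) (W l) : ℂ)

omit [AddCommGroup V] [Module ℂ V] in
theorem complexify_re (R : V → V → V → V → ℝ) (X Y Z W : Fin 2 → V) :
    (complexify R X Y Z W).re =
      R (X 0) (Y 0) (Z 0) (W 0) - R (X 1) (Y 1) (Z 0) (W 0) - R (X 1) (Y 0) (Z 1) (W 0)
      - R (X 1) (Y 0) (Z 0) (W 1) - R (X 0) (Y 1) (Z 1) (W 0) - R (X 0) (Y 1) (Z 0) (W 1)
      - R (X 0) (Y 0) (Z 1) (W 1) + R (X 1) (Y 1) (Z 1) (W 1) := by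
  have h3 : Complex.I ^ 3 = -Complex.I := Complex.I_pow_three
  have h4 : Complex.I ^ 4 = 1 := Complex.I_pow_four
  simp [complexify, Fin.sum_univ_two, h3]
  ring

/-- If the components `R_{αβγδ}`, `R_{αβγ\bar δ}` and `R_{αβ\bar γ\bar δ}` of an algebraic curvature
tensor vanish, then it is of Kähler type. -/
theorem IsCurvatureTensor.I_smul_I_smul_left {R : V → V → V → V → ℝ} (hR : IsCurvatureTensor R)
    (h0 : ∀ u v w z, R u v w z - R (Complex.I • u) (Complex.I • v) w z
      - R (Complex.I • u) v (Complex.I • w) z - R (Complex.I • u) v w (Complex.I • z)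
      - R u (Complex.I • v) (Complex.I • w) z - R u (Complex.I • v) w (Complex.I • z)
      - R u v (Complex.I • w) (Complex.I • z)
      + R (Complex.I • u) (Complex.I • v) (Complex.I • w) (Complex.I • z) = 0)
    (h1 : ∀ a b c d : V, complexify R ![(1 / 2 : ℝ) • a, -((1 / 2 : ℝ) • Complex.I • a)]
      ![(1 / 2 : ℝ) • b, -((1 / 2 : ℝ) • Complex.I • b)]
      ![(1 / 2 : ℝ) • c, -((1 / 2 : ℝ) • Complex.I • c)]
      ![(1 / 2 : ℝ) • d, (1 / 2 : ℝ) • Complex.I • d] = 0)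
    (h2 : ∀ a b c d : V, complexify R ![(1 / 2 : ℝ) • a, -((1 / 2 : ℝ) • Complex.I • a)]
      ![(1 / 2 : ℝ) • b, -((1 / 2 : ℝ) • Complex.I • b)]
      ![(1 / 2 : ℝ) • c, (1 / 2 : ℝ) • Complex.I • c]
      ![(1 / 2 : ℝ) • d, (1 / 2 : ℝ) • Complex.I • d] = 0)
    (u v w z : V) : R (Complex.I • u) (Complex.I • v) w z = R u v w z := by
  -- Summing over the types of the last two slots gives `R(U, V, w, z) = 0` for the `(1, 0)`-vectors
  -- `U = u - i J u` and `V = v - i J v`; its real part is the claim.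
  have e0 := h0 u v w z
  have e1 := congrArg Complex.re (h1 u v w z)
  have e1' := congrArg Complex.re (h1 u v z w)
  have e2 := congrArg Complex.re (h2 u v w z)
  simp only [complexify_re, Matrix.cons_val_zero, Matrix.cons_val_one, Complex.zero_re,
    hR.neg_left, hR.neg_two, hR.neg_three, hR.smul_left, hR.smul_two, hR.smul_three,
    hR.smul_four] at e1 e1' e2
  rw [hR.swap_right _ _ w z, hR.swap_right _ _ w z, hR.swap_right _ _ (Complex.I • w) z,
    hR.swap_right _ _ w (Complex.I • z), hR.swap_right _ _ (Complex.I • w) z,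
    hR.swap_right _ _ w (Complex.I • z), hR.swap_right _ _ (Complex.I • w) (Complex.I • z),
    hR.swap_right _ _ (Complex.I • w) (Complex.I • z)] at e1'
  linarith

end Gray

/-! ### The sectional curvature of a Gray-Kähler-like metric -/

/-- In the chart around `p` the coordinate frame at `p` is the identity of `T_p M = E`. -/
theorem chartFrame_self {E : Type*} [NormedAddCommGroup E] [NormedSpace ℂ E]
    {M : Type*} [TopologicalSpace M] [ChartedSpace E M] [IsManifold 𝓘(ℂ, E) ω M] (p : M) (u : E) :
    (chartFrame p (chartAt E p p) u : E) = u := by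
  have : IsManifold 𝓘(ℂ, E) 1 M := .of_le (n := ω) le_top
  have h := mfderivWithin_range_extChartAt_symm (I := 𝓘(ℂ, E)) (x := p)
  simp only [mfld_simps, mfderivWithin_univ] at h
  exact congrArg (fun L : E →L[ℂ] E => L u) h

namespace HermitianMetric

variable {E : Type*} [NormedAddCommGroup E] [NormedSpace ℂ E]
  {M : Type*} [TopologicalSpace M] [ChartedSpace E M] (h : HermitianMetric E M)

theorem riem_symm (x : M) (u v : TangentSpace 𝓘(ℂ, E) x) : h.riem x u v = h.riem x v u := by
  rw [riem, riem, ← h.conj_symm x v u, Complex.conj_re]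

theorem riem_I_smul (x : M) (u v : TangentSpace 𝓘(ℂ, E) x) :
    h.riem x (Complex.I • u) (Complex.I • v) = h.riem x u v := by
  simp [riem]

variable [FiniteDimensional ℂ E]

theorem chartMetric_symm (p : M) (y u v : E) : h.chartMetric p y u v = h.chartMetric p y v u :=
  h.riem_symm _ _ _

theorem chartMetric_I_smul (p : M) (y u v : E) :
    h.chartMetric p y (Complex.I • u) (Complex.I • v) = h.chartMetric p y u v := by
  have := h.riem_I_smul ((chartAt E p).symm y) (chartFrame p y u) (chartFrame p y v)
  rw [← map_smul, ← map_smul] at this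
  exact this

theorem chartMetric_self [IsManifold 𝓘(ℂ, E) ω M] (p : M) (u v : E) :
    h.chartMetric p (chartAt E p p) u v = h.riem p u v := by
  -- The base point `φ⁻¹(φ(p))` is only propositionally equal to `p`.
  have key : ∀ x, x = p → ∀ u v : E, h.riem x u v = h.riem p u v := by
    rintro x rfl u v; rfl
  have h1 := key ((chartAt E p).symm (chartAt E p p))
    ((chartAt E p).left_inv (mem_chart_source E p))
    (chartFrame p (chartAt E p p) u) (chartFrame p (chartAt E p p) v)
  refine h1.trans ?_
  rw [chartFrame_self p u, chartFrame_self p v]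

theorem contDiffAt_chartMetric (p : M) : ContDiffAt ℝ 2 (h.chartMetric p) (chartAt E p p) := by
  have : FiniteDimensional ℝ E := FiniteDimensional.complexToReal E
  have h1 : ContDiffOn ℝ 2 (h.chartMetric p) (chartAt E p).target := by
    refine contDiffOn_clm_apply.2 fun u => contDiffOn_clm_apply.2 fun v => ?_
    exact Complex.reCLM.contDiff.comp_contDiffOn ((h.smooth p u v).of_le
      (WithTop.coe_le_coe.2 (le_top : (2 : ℕ∞) ≤ ⊤)))
  exact h1.contDiffAt ((chartAt E p).open_target.mem_nhds (mem_chart_target E p))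

variable [IsManifold 𝓘(ℂ, E) ω M]

theorem chartMetric_self_pos (p : M) (u : E) (hu : u ≠ 0) :
    0 < h.chartMetric p (chartAt E p p) u u := by
  rw [chartMetric_self]; exact h.pos p u hu

theorem isInvertible_chartMetric (p : M) : (h.chartMetric p (chartAt E p p)).IsInvertible :=
  have : FiniteDimensional ℝ E := FiniteDimensional.complexToReal E
  isInvertible_of_pos (h.chartMetric_self_pos p)

theorem isCurvatureTensor_curvature (p : M) :
    IsCurvatureTensor (V := E) (fun u v w z : E => h.curvature p u v w z) :=
  have : CompleteSpace E := FiniteDimensional.complete ℂ E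
  isCurvatureTensor_localCurvature (h.contDiffAt_chartMetric p) (h.isInvertible_chartMetric p)
    (.of_forall fun x => h.chartMetric_symm p x)

/-- The Gray-Kähler-like condition, together with the vanishing of `R_{αβγδ}` that holds for every
Hermitian metric, makes the curvature tensor one of Kähler type. -/
theorem IsGKahlerLike.curvature_I_smul {h : HermitianMetric E M} (hG : h.IsGKahlerLike) (p : M)
    (u v w z : E) :
    h.curvature p (Complex.I • u : E) (Complex.I • v : E) w z = h.curvature p u v w z :=
  have : CompleteSpace E := FiniteDimensional.complete ℂ E
  (h.isCurvatureTensor_curvature p).I_smul_I_smul_left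
    (localCurvature_holomorphic_eq_zero (h.contDiffAt_chartMetric p)
      (h.isInvertible_chartMetric p) (.of_forall fun x => h.chartMetric_symm p x)
      (.of_forall fun x => h.chartMetric_I_smul p x))
    (fun a b c d => (hG p a b c d).1) (fun a b c d => (hG p a b c d).2) u v w z

theorem continuous_curvature (p : M) :
    Continuous fun x : E => h.curvature p x (Complex.I • x : E) (Complex.I • x : E) x :=
  have : CompleteSpace E := FiniteDimensional.complete ℂ E
  continuous_localCurvature (h.contDiffAt_chartMetric p) (h.isInvertible_chartMetric p)
    (.of_forall fun x => h.chartMetric_symm p x) continuous_id (continuous_const_smul _)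
    (continuous_const_smul _) continuous_id

theorem sectionalCurvature_eq (p : M) (u v : E) :
    h.sectionalCurvature p u v = algSectionalCurvature (h.chartMetric p (chartAt E p p))
      (fun u v w z : E => h.curvature p u v w z) u v := by
  simp only [algSectionalCurvature, chartMetric_self]
  rfl

theorem riem_J_self (p : M) (u : TangentSpace 𝓘(ℂ, E) p) : h.riem p u (J u) = 0 := by
  have := metric_I_smul_self (h.chartMetric_symm p (chartAt E p p))
    (h.chartMetric_I_smul p (chartAt E p p)) u
  exact (h.chartMetric_self p u (Complex.I • u : E)).symm.trans this

omit [FiniteDimensional ℂ E] [IsManifold 𝓘(ℂ, E) ω M] in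
theorem J_ne_zero {p : M} {u : TangentSpace 𝓘(ℂ, E) p} (hu : u ≠ 0) : J u ≠ 0 :=
  smul_ne_zero Complex.I_ne_zero hu

theorem sectionalCurvature_J_mem (p : M) {y : TangentSpace 𝓘(ℂ, E) p} (hy : y ≠ 0) :
    h.sectionalCurvature p y (J y) ∈ h.orthogonalCurvatures p :=
  ⟨y, J y, hy, J_ne_zero hy, h.riem_J_self p y, rfl⟩

theorem linearIndependent_of_riem_eq_zero (p : M) {u v : TangentSpace 𝓘(ℂ, E) p} (hu : u ≠ 0)
    (hv : v ≠ 0) (huv : h.riem p u v = 0) : LinearIndependent ℝ ![u, v] :=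
  linearIndependent_pair_of_metric_eq_zero (h.chartMetric_symm p (chartAt E p p))
    (h.chartMetric_self_pos p) hu hv ((h.chartMetric_self p u v).trans huv)

omit [IsManifold 𝓘(ℂ, E) ω M] in
theorem curvature_eq_sectionalCurvature_mul (p : M) {u v : TangentSpace 𝓘(ℂ, E) p} (hu : u ≠ 0)
    (hv : v ≠ 0) (huv : h.riem p u v = 0) :
    h.curvature p u v v u = h.sectionalCurvature p u v * (h.riem p u u * h.riem p v v) := by
  have h1 : 0 < h.riem p u u := h.pos p u hu
  have h2 : 0 < h.riem p v v := h.pos p v hv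
  rw [sectionalCurvature, huv]
  field_simp
  ring

theorem NonnegSectionalCurvature.curvature_nonneg {h : HermitianMetric E M}
    (hK : h.NonnegSectionalCurvature) (p : M) (u v : TangentSpace 𝓘(ℂ, E) p)
    (huv : h.riem p u v = 0) : 0 ≤ h.curvature p u v v u := by
  rcases eq_or_ne u 0 with rfl | hu
  · simpa using! ((h.isCurvatureTensor_curvature p).smul_left 0 0 v v 0).ge
  rcases eq_or_ne v 0 with rfl | hv
  · simpa using! ((h.isCurvatureTensor_curvature p).smul_two 0 u 0 0 u).ge
  rw [h.curvature_eq_sectionalCurvature_mul p hu hv huv]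
  exact mul_nonneg (hK p u v (h.linearIndependent_of_riem_eq_zero p hu hv huv))
    (mul_pos (h.pos p u hu) (h.pos p v hv)).le

theorem NonposSectionalCurvature.curvature_nonpos {h : HermitianMetric E M}
    (hK : h.NonposSectionalCurvature) (p : M) (u v : TangentSpace 𝓘(ℂ, E) p)
    (huv : h.riem p u v = 0) : h.curvature p u v v u ≤ 0 := by
  rcases eq_or_ne u 0 with rfl | hu
  · simpa using! ((h.isCurvatureTensor_curvature p).smul_left 0 0 v v 0).le
  rcases eq_or_ne v 0 with rfl | hv
  · simpa using! ((h.isCurvatureTensor_curvature p).smul_two 0 u 0 0 u).le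
  rw [h.curvature_eq_sectionalCurvature_mul p hu hv huv]
  exact mul_nonpos_of_nonpos_of_nonneg
    (hK p u v (h.linearIndependent_of_riem_eq_zero p hu hv huv))
    (mul_pos (h.pos p u hu) (h.pos p v hv)).le

theorem exists_isGreatest_sectionalCurvature_J [Nontrivial E] {h : HermitianMetric E M}
    (hG : h.IsGKahlerLike) (hK : h.NonnegSectionalCurvature) (p : M) :
    ∃ y : TangentSpace 𝓘(ℂ, E) p, y ≠ 0 ∧
      IsGreatest (h.orthogonalCurvatures p) (h.sectionalCurvature p y (J y)) := by
  obtain ⟨y, hy, hmax⟩ := exists_forall_algSectionalCurvature_le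
    (h.chartMetric_symm p (chartAt E p p)) (h.chartMetric_I_smul p (chartAt E p p))
    (h.chartMetric_self_pos p) (h.isCurvatureTensor_curvature p) (hG.curvature_I_smul p)
    (fun u v huv => hK.curvature_nonneg p u v ((h.chartMetric_self p u v).symm.trans huv))
    (h.continuous_curvature p)
  refine ⟨y, hy, h.sectionalCurvature_J_mem p hy, ?_⟩
  rintro c ⟨u, v, hu, hv, huv, rfl⟩
  have := hmax u v hu hv ((h.chartMetric_self p u v).trans huv)
  exact ((h.sectionalCurvature_eq p u v).trans_le this).trans_eq
    (h.sectionalCurvature_eq p y (Complex.I • y : E)).symm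

theorem exists_isLeast_sectionalCurvature_J [Nontrivial E] {h : HermitianMetric E M}
    (hG : h.IsGKahlerLike) (hK : h.NonposSectionalCurvature) (p : M) :
    ∃ y : TangentSpace 𝓘(ℂ, E) p, y ≠ 0 ∧
      IsLeast (h.orthogonalCurvatures p) (h.sectionalCurvature p y (J y)) := by
  -- Apply the upper bound to the curvature tensor `-R`, which is again of Kähler type.
  obtain ⟨y, hy, hmax⟩ := exists_forall_algSectionalCurvature_le
    (h.chartMetric_symm p (chartAt E p p)) (h.chartMetric_I_smul p (chartAt E p p))
    (h.chartMetric_self_pos p) (h.isCurvatureTensor_curvature p).neg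
    (fun u v w z => congrArg Neg.neg (hG.curvature_I_smul p u v w z))
    (fun u v huv => neg_nonneg.2
      (hK.curvature_nonpos p u v ((h.chartMetric_self p u v).symm.trans huv)))
    (h.continuous_curvature p).neg
  refine ⟨y, hy, h.sectionalCurvature_J_mem p hy, ?_⟩
  rintro c ⟨u, v, hu, hv, huv, rfl⟩
  have hneg := algSectionalCurvature_neg (h.chartMetric p (chartAt E p p))
    (fun u v w z : E => h.curvature p u v w z)
  have := neg_le_neg_iff.1 (((hneg u v).symm.trans_le
    (hmax u v hu hv ((h.chartMetric_self p u v).trans huv))).trans_eq (hneg y (Complex.I • y : E)))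
  exact ((h.sectionalCurvature_eq p y (Complex.I • y : E)).trans_le this).trans_eq
    (h.sectionalCurvature_eq p u v).symm

end HermitianMetric

theorem theorem1p3 {E : Type*} [NormedAddCommGroup E] [NormedSpace ℂ E] [FiniteDimensional ℂ E]
    [Nontrivial E] {M : Type*} [TopologicalSpace M] [ChartedSpace E M] [IsManifold 𝓘(ℂ, E) ω M]
    (h : HermitianMetric E M) (hG : h.IsGKahlerLike) :
    (h.NonnegSectionalCurvature →
      (∀ p : M, ∃ y : TangentSpace 𝓘(ℂ, E) p, y ≠ 0 ∧
        IsGreatest (h.orthogonalCurvatures p)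
          (h.sectionalCurvature p y (HermitianMetric.J y))) ∧
      (∀ c : ℝ, IsGreatest (⋃ p : M, h.orthogonalCurvatures p) c →
        ∃ (p : M) (y : TangentSpace 𝓘(ℂ, E) p), y ≠ 0 ∧
          h.sectionalCurvature p y (HermitianMetric.J y) = c)) ∧
    (h.NonposSectionalCurvature →
      (∀ p : M, ∃ y : TangentSpace 𝓘(ℂ, E) p, y ≠ 0 ∧
        IsLeast (h.orthogonalCurvatures p)
          (h.sectionalCurvature p y (HermitianMetric.J y))) ∧
      (∀ c : ℝ, IsLeast (⋃ p : M, h.orthogonalCurvatures p) c →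
        ∃ (p : M) (y : TangentSpace 𝓘(ℂ, E) p), y ≠ 0 ∧
          h.sectionalCurvature p y (HermitianMetric.J y) = c)) := by
  refine ⟨fun hK => ?_, fun hK => ?_⟩
  · have hmax := HermitianMetric.exists_isGreatest_sectionalCurvature_J hG hK
    refine ⟨hmax, fun c hc => ?_⟩
    obtain ⟨p, hp⟩ := Set.mem_iUnion.1 hc.1
    obtain ⟨y, hy, hmem, hle⟩ := hmax p
    exact ⟨p, y, hy, le_antisymm (hc.2 (Set.mem_iUnion.2 ⟨p, hmem⟩)) (hle hp)⟩
  · have hmin := HermitianMetric.exists_isLeast_sectionalCurvature_J hG hK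
    refine ⟨hmin, fun c hc => ?_⟩
    obtain ⟨p, hp⟩ := Set.mem_iUnion.1 hc.1
    obtain ⟨y, hy, hmem, hle⟩ := hmin p
    exact ⟨p, y, hy, le_antisymm (hle hp) (hc.2 (Set.mem_iUnion.2 ⟨p, hmem⟩))⟩
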